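/- Let $P$ be a discrete-time LTI plant with state recursion $x(i+1)=Ax(i)+B_1d(i)+B_2u(i)$, $e(i)=C_1x(i)+D_{11}d(i)+D_{12}u(i)$, $y(i)=C_2x(i)+D_{21}d(i)$, where $u$ and $y$ are scalar, and let $P_{21},P_{22}$ be its transfer functions from $d$ and from $u$ to $y$. Let $L=[L_w,L_y]$ and $F$ be proper LTI filters with finite-dimensional state-space realizations, and consider the feedback loop $$u=Fw,\qquad w=v+q,\qquad v=L_wz^{-1}w+L_yy,$$ with $F$, $L$ and the delay $z^{-1}$ initially at rest. Assume that the loop is internally stable, i.e. for zero inputs its whole state (plant, delay, filters) tends to $0$ from every initial state. Let the initial plant state $x_0$ and the disturbance $d$ be jointly Gaussian, $d$ being white with zero mean and identity covariance, and let $q$ be zero-mean white Gaussian noise of variance $\sigma_q^2>0$, independent of $(x_0,d)$; then $v$ is Gaussian. Let $\sigma_v^2=\lim_{t\to\infty}\operatorname{var}v(t)$ and $\gamma=\sigma_v^2/\sigma_q^2$. Put $S=(1-L_wz^{-1}-P_{22}FL_y)^{-1}$, let $\|\cdot\|$ denote the $2$-norm of a transfer function (the square root of the energy of its impulse response), and assume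 $\gamma>\|S-1\|^2$, where $\|S-1\|^2$ is the critical signal-to-noise ratio of the loop. Let $k\ge 2$ and $1\le k'\le k$, and let $q_1,\dots,q_k$ be noises (real random processes in the time index) such that at each time every $q_i$ has zero mean and finite variance $\sigma^2>0$, and every two distinct $q_i,q_j$ have correlation coefficient $\rho$, where $-\frac1{k-1}<\rho\le 0$. Suppose that $$\sigma^2\le\frac{\gamma\,k'\,\|L_yP_{21}S\|^2}{\|S-1\|^2\,(\gamma-\|S-1\|^2)\,(1+(k'-1)\rho)},$$ where the right-hand side is read as $+\infty$ if $\|S-1\|=0$. Then the descriptions $y_i=v+q_i$, $i=1,\dots,k$, form a $(k,k')$ stabilizing code for the system: for every set $I\subseteq\{1,\dots,k\}$ with $k'$ elements, 1. averaging the descriptions with index in $I$ gives a signal-to-noise ratio that is not below the critical one at any time, $$\frac{\sigma_v^2}{\operatorname{var}\big(\frac1{k'}\sum_{i\in I}q_i\big)}\ \ge\ \|S-1\|^2;$$ 2. the loop in which $w=v+q$ is replaced by $w=\frac1{k'}\sum_{i\in I}(v+q_i)$ (with the same $x_0$, $d$, and with $v$ generated by this loop) is mean-square stable: $\sup_t\mathbb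 E[x(t)x(t)^{T}]<\infty$. -/

import Mathlib

open MeasureTheory ProbabilityTheory Filter Topology
open scoped Matrix PowerSeries

namespace NCS

/-! ### Transfer functions

A proper scalar discrete-time LTI transfer function is represented by its expansion in powers of
`z⁻¹`, that is, by the formal power series in `X = z⁻¹` whose coefficients are its impulse
response. -/

/-- The transfer function `δ + c (zI - A)⁻¹ b`: its impulse response is
`δ, c b, c A b, c A² b, …`. -/
noncomputable def transferFn {n : ℕ} (A : Matrix (Fin n) (Fin n) ℝ) (b c : Fin n → ℝ) (δ : ℝ) :
    ℝ⟦X⟧ :=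
  PowerSeries.mk fun t => Nat.casesOn t δ fun s => c ⬝ᵥ ((A ^ s) *ᵥ b)

/-- The squared `2`-norm of a scalar transfer function: the energy of its impulse response. -/
noncomputable def normSq (H : ℝ⟦X⟧) : ℝ := ∑' t : ℕ, (PowerSeries.coeff t H) ^ 2

/-- The squared `2`-norm of a row of scalar transfer functions. -/
noncomputable def normSqRow {m : ℕ} (H : Fin m → ℝ⟦X⟧) : ℝ := ∑ j, normSq (H j)

/-! ### The plant, the filters and the feedback loop -/

/-- The plant `P`, with state dimension `n`, disturbance `d` of dimension `m`, error signal `e` of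
dimension `p`, scalar control input `u` and scalar sensor output `y`:
`x(i+1) = A x(i) + B₁ d(i) + B₂ u(i)`, `e(i) = C₁ x(i) + D₁₁ d(i) + D₁₂ u(i)`,
`y(i) = C₂ x(i) + D₂₁ d(i)`. -/
structure Plant (n m p : ℕ) where
  A : Matrix (Fin n) (Fin n) ℝ
  B₁ : Matrix (Fin n) (Fin m) ℝ
  B₂ : Fin n → ℝ
  C₁ : Matrix (Fin p) (Fin n) ℝ
  C₂ : Fin n → ℝ
  D₁₁ : Matrix (Fin p) (Fin m) ℝ
  D₁₂ : Fin p → ℝ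
  D₂₁ : Fin m → ℝ

/-- A proper LTI filter with `r` scalar inputs and one scalar output, given by a state-space
realization with `n` states. -/
structure LTIFilter (n r : ℕ) where
  A : Matrix (Fin n) (Fin n) ℝ
  B : Matrix (Fin n) (Fin r) ℝ
  C : Fin n → ℝ
  D : Fin r → ℝ

namespace LTIFilter

variable {n r : ℕ}

/-- The transfer function from the `j`-th input to the output. -/
noncomputable def transfer (H : LTIFilter n r) (j : Fin r) : ℝ⟦X⟧ :=
  transferFn H.A (fun i => H.B i j) H.C (H.D j)

/-- The output at the current time, from the state and the current input. -/
def out (H : LTIFilter n r) (ξ : Fin n → ℝ) (a : Fin r → ℝ) : ℝ := H.C ⬝ᵥ ξ + H.D ⬝ᵥ a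

/-- The state at the next time. -/
def next (H : LTIFilter n r) (ξ : Fin n → ℝ) (a : Fin r → ℝ) : Fin n → ℝ := H.A *ᵥ ξ + H.B *ᵥ a

end LTIFilter

/-- The feedback loop: a plant `P`, the filter `L = [L_w, L_y]` producing
`v = L_w z⁻¹ w + L_y y`, and the filter `F` producing `u = F w`. -/
structure Loop (n m p nL nF : ℕ) where
  P : Plant n m p
  L : LTIFilter nL 2
  F : LTIFilter nF 1

/-- The state of the loop: the plant state, the delayed signal `w(i-1)`, and the states of the
filters `L` and `F`. -/
abbrev LoopState (n nL nF : ℕ) : Type := (Fin n → ℝ) × ℝ × (Fin nL → ℝ) × (Fin nF → ℝ)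

namespace Loop

variable {n m p nL nF : ℕ} (sys : Loop n m p nL nF)

/-! #### Transfer functions of the loop -/

/-- `P₂₁`, from the disturbance `d` to the sensor output `y`. -/
noncomputable def P₂₁ (j : Fin m) : ℝ⟦X⟧ :=
  transferFn sys.P.A (fun i => sys.P.B₁ i j) sys.P.C₂ (sys.P.D₂₁ j)

/-- `P₂₂`, from the control input `u` to the sensor output `y`. -/
noncomputable def P₂₂ : ℝ⟦X⟧ := transferFn sys.P.A sys.P.B₂ sys.P.C₂ 0

/-- `L_w`. -/
noncomputable def Lw : ℝ⟦X⟧ := sys.L.transfer 0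

/-- `L_y`. -/
noncomputable def Ly : ℝ⟦X⟧ := sys.L.transfer 1

/-- The transfer function of `F`. -/
noncomputable def Ftf : ℝ⟦X⟧ := sys.F.transfer 0

/-- `S = (1 - L_w z⁻¹ - P₂₂ F L_y)⁻¹`; the inverted series has constant coefficient `1`. -/
noncomputable def S : ℝ⟦X⟧ := (1 - sys.Lw * PowerSeries.X - sys.P₂₂ * sys.Ftf * sys.Ly)⁻¹

/-- `‖S - 1‖²`, the minimal signal-to-noise ratio required for stability. -/
noncomputable def criticalSNR : ℝ := normSq (sys.S - 1)

/-- `‖L_y P₂₁ S‖²`. -/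
noncomputable def normSqLyP₂₁S : ℝ := normSqRow fun j => sys.Ly * sys.P₂₁ j * sys.S

/-! #### Time-domain behaviour of the loop -/

/-- The sensor output `y(i)`. -/
def outY (s : LoopState n nL nF) (d : Fin m → ℝ) : ℝ := sys.P.C₂ ⬝ᵥ s.1 + sys.P.D₂₁ ⬝ᵥ d

/-- The signal `v(i)` produced by `L` from `w(i-1)` and `y(i)`. -/
def outV (s : LoopState n nL nF) (d : Fin m → ℝ) : ℝ :=
  sys.L.out s.2.2.1 ![s.2.1, sys.outY s d]

/-- One time step of the loop, given the state, `d(i)` and `w(i)`. -/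
def step (s : LoopState n nL nF) (d : Fin m → ℝ) (w : ℝ) : LoopState n nL nF :=
  (sys.P.A *ᵥ s.1 + sys.P.B₁ *ᵥ d + sys.F.out s.2.2.2 ![w] • sys.P.B₂,
    w,
    sys.L.next s.2.2.1 ![s.2.1, sys.outY s d],
    sys.F.next s.2.2.2 ![w])

/-- The trajectory of the loop closed through the channel `chan`, that is, with
`w(i) = chan i (v(i))`. Since `P₂₂` is strictly proper, the loop is always well-posed. -/
def run (s₀ : LoopState n nL nF) (d : ℕ → Fin m → ℝ) (chan : ℕ → ℝ → ℝ) : ℕ → LoopState n nL nF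
  | 0 => s₀
  | t + 1 =>
      sys.step (run s₀ d chan t) (d t) (chan t (sys.outV (run s₀ d chan t) (d t)))

/-- Internal stability: the loop closed by `w = v`, without any external input, returns to rest
from every initial state of plant, delay and filters. -/
def InternallyStable : Prop :=
  ∀ s₀ : LoopState n nL nF, Tendsto (sys.run s₀ (fun _ => 0) fun _ v => v) atTop (𝓝 0)

/-- The plant state `x(t)` of the loop with initial plant state `x₀`, the delay and the filters
starting at rest. -/
def plantState (x₀ : Fin n → ℝ) (d : ℕ → Fin m → ℝ) (chan : ℕ → ℝ → ℝ) (t : ℕ) : Fin n → ℝ :=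
  (sys.run (x₀, 0, 0, 0) d chan t).1

/-- The signal `v(t)` of the loop with initial plant state `x₀`, the delay and the filters
starting at rest. -/
def signalV (x₀ : Fin n → ℝ) (d : ℕ → Fin m → ℝ) (chan : ℕ → ℝ → ℝ) (t : ℕ) : ℝ :=
  sys.outV (sys.run (x₀, 0, 0, 0) d chan t) (d t)

end Loop

/-! ### Stochastic part -/

section Stochastic

variable {Ω : Type*} [MeasurableSpace Ω]

/-- Mean-square stability: `sup_t E[x(t) x(t)ᵀ] < ∞`, entrywise. -/
def MeanSquareStable {n : ℕ} (μ : Measure Ω) (x : ℕ → Ω → Fin n → ℝ) : Prop :=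
  ∀ i j, ∃ C : ℝ, ∀ t, Integrable (fun ω => x t ω i * x t ω j) μ ∧
    |∫ ω, x t ω i * x t ω j ∂μ| ≤ C

/-- The correlation coefficient of two random variables. -/
noncomputable def corr (X Y : Ω → ℝ) (μ : Measure Ω) : ℝ :=
  cov[X, Y; μ] / (√(Var[X; μ]) * √(Var[Y; μ]))

/-- The initial plant state `x₀` and the disturbance `d` are jointly Gaussian, and `d` is white
with zero mean and identity covariance matrix. -/
structure IsGaussianDisturbance {n m : ℕ} (μ : Measure Ω) (x₀ : Ω → Fin n → ℝ)
    (d : ℕ → Ω → Fin m → ℝ) : Prop where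
  gaussian : IsGaussianProcess
    (Sum.elim (fun (i : Fin n) ω => x₀ ω i) fun (a : ℕ × Fin m) ω => d a.1 ω a.2) μ
  mean : ∀ t j, ∫ ω, d t ω j ∂μ = 0
  cov : ∀ t s i j, cov[fun ω => d t ω i, fun ω => d s ω j; μ] = if t = s ∧ i = j then 1 else 0

/-- `q` is white Gaussian noise with zero mean and variance `varQ`. -/
structure IsWhiteGaussianNoise (μ : Measure Ω) (q : ℕ → Ω → ℝ) (varQ : ℝ) : Prop where
  gaussian : IsGaussianProcess q μ
  mean : ∀ t, ∫ ω, q t ω ∂μ = 0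
  cov : ∀ t s, cov[q t, q s; μ] = if t = s then varQ else 0

/-- The linear system `(F, L, P, γ)`: the loop is internally stable and closed by `w = v + q`, with
`q` white Gaussian noise of positive variance `varQ`, independent of the initial plant state and
the Gaussian disturbance; `varV` is the steady-state variance of `v` (which is Gaussian), and `γ`
is the signal-to-noise ratio `varV / varQ`. -/
structure IsLinearSystem {n m p nL nF : ℕ} (sys : Loop n m p nL nF) (μ : Measure Ω)
    (x₀ : Ω → Fin n → ℝ) (d : ℕ → Ω → Fin m → ℝ) (q : ℕ → Ω → ℝ) (varQ varV γ : ℝ) : Prop where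
  stable : sys.InternallyStable
  disturbance : IsGaussianDisturbance μ x₀ d
  noise : IsWhiteGaussianNoise μ q varQ
  indep : IndepFun (fun ω t => q t ω) (fun ω => (x₀ ω, fun t => d t ω)) μ
  varQ_pos : 0 < varQ
  tendsto_varV : Tendsto
    (fun t => Var[fun ω => sys.signalV (x₀ ω) (fun t => d t ω) (fun t v => v + q t ω) t; μ])
    atTop (𝓝 varV)
  snr : γ = varV / varQ

/-- The reconstruction from the received descriptions: the average of those with index in `I`. -/
noncomputable def average {k : ℕ} (I : Finset (Fin k)) (y : Fin k → ℝ) : ℝ :=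
  (∑ i ∈ I, y i) / (I.card : ℝ)

/-- The descriptions `y_i = v + q_i`, `i = 1, …, k`, form a `(k, k')` stabilizing code: for every
set `I` of `k'` received descriptions, averaging them yields a signal-to-noise ratio not below the
critical one, and the loop that is closed by `w = average of the received y_i` is mean-square
stable. -/
def IsStabilizingCode {n m p nL nF : ℕ} (sys : Loop n m p nL nF) (μ : Measure Ω)
    (x₀ : Ω → Fin n → ℝ) (d : ℕ → Ω → Fin m → ℝ) (varV : ℝ) {k : ℕ} (k' : ℕ)
    (q : Fin k → ℕ → Ω → ℝ) : Prop :=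
  ∀ I : Finset (Fin k), I.card = k' →
    (∀ t, sys.criticalSNR ≤ varV / Var[fun ω => average I fun i => q i t ω; μ]) ∧
    MeanSquareStable μ fun t ω =>
      sys.plantState (x₀ ω) (fun t => d t ω) (fun t v => average I fun i => v + q i t ω) t

end Stochastic

end NCS

/-!
The loop closed by `w = v + q` is a linear recursion `z (t + 1) = Φ (z t) + B (d t, q t)` for its
whole state, and internal stability says that the powers of `Φ` tend to zero, hence are summable in
norm since the state space is finite-dimensional (`Loop.InternallyStable.summable_norm_pow`).

Started at rest, the loop maps `q` and `d` to `v` through `S - 1` and `L_y P₂₁ S`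
(`Loop.mk_signal_eq`). For white `q` and `d`, with `q` independent of `d`, the energies of these
impulse responses add up; the response to the initial state, although possibly correlated with `d`,
has vanishing variance. Hence `σ_v² = ‖S - 1‖² σ_q² + ‖L_y P₂₁ S‖²` (`IsLinearSystem.varV_eq`), that
is, `‖L_y P₂₁ S‖² = (γ - ‖S - 1‖²) σ_q²`. The bound on `σ²` then reads
`σ² (1 + (k' - 1) ρ) / k' ≤ σ_v² / ‖S - 1‖²`, and its left-hand side is the variance of the average
of `k'` of the noises (`variance_average`).

Mean-square stability needs only that the averaged noise has bounded power: it may be correlated in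
time and with `x₀` and `d`, because the bound comes from the summability of `‖Φ ^ t‖` by
Cauchy–Schwarz (`exists_integral_sq_norm_le_of_recurrence`).
-/

namespace NCS

/-! ### Linear recursions -/

/-- Variation of constants for the recursion `z (t + 1) = Φ (z t) + f t`. -/
lemma eq_pow_add_sum_of_recurrence {E : Type*} [AddCommGroup E] [Module ℝ E] (Φ : Module.End ℝ E)
    {z f : ℕ → E} (h : ∀ t, z (t + 1) = Φ (z t) + f t) (t : ℕ) :
    z t = (Φ ^ t) (z 0) + ∑ s ∈ Finset.range t, (Φ ^ (t - 1 - s)) (f s) := by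
  induction t with
  | zero => simp
  | succ t ih =>
    rw [h, ih, Finset.sum_range_succ, map_add, map_sum, pow_succ', add_assoc]
    simp only [Module.End.mul_apply, Nat.add_sub_cancel, Nat.sub_self, pow_zero,
      Module.End.one_apply]
    congr 2
    refine Finset.sum_congr rfl fun s hs => ?_
    rw [← Module.End.mul_apply, ← pow_succ']
    congr 2
    have := Finset.mem_range.1 hs
    omega

lemma coeff_transferFn_mul {n : ℕ} (A : Matrix (Fin n) (Fin n) ℝ) (b c : Fin n → ℝ) (δ : ℝ)
    (a : ℕ → ℝ) (t : ℕ) :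
    PowerSeries.coeff t (transferFn A b c δ * PowerSeries.mk a) =
      (∑ s ∈ Finset.range t, c ⬝ᵥ ((A ^ (t - 1 - s)) *ᵥ b) * a s) + δ * a t := by
  rw [mul_comm, PowerSeries.coeff_mul, Finset.Nat.sum_antidiagonal_eq_sum_range_succ_mk,
    Finset.sum_range_succ]
  simp only [transferFn, PowerSeries.coeff_mk, Nat.sub_self]
  rw [mul_comm (a t)]
  congr 1
  refine Finset.sum_congr rfl fun s hs => ?_
  have := Finset.mem_range.1 hs
  obtain ⟨r, hr⟩ : ∃ r, t - s = r + 1 := ⟨t - 1 - s, by omega⟩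
  rw [hr, show t - 1 - s = r by omega, mul_comm]

/-- A state-space realization started at rest acts on its input by its transfer functions. -/
lemma output_eq_coeff_transferFn {n : ℕ} {ι : Type*} [Fintype ι] (A : Matrix (Fin n) (Fin n) ℝ)
    (B : Matrix (Fin n) ι ℝ) (c : Fin n → ℝ) (D : ι → ℝ) {ξ : ℕ → Fin n → ℝ} {a : ℕ → ι → ℝ}
    (h0 : ξ 0 = 0) (h : ∀ t, ξ (t + 1) = A *ᵥ ξ t + B *ᵥ a t) (t : ℕ) :
    c ⬝ᵥ ξ t + D ⬝ᵥ a t = PowerSeries.coeff t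
      (∑ j, transferFn A (fun i => B i j) c (D j) * PowerSeries.mk fun s => a s j) := by
  rw [map_sum]
  simp only [coeff_transferFn_mul, Finset.sum_add_distrib]
  congr 1
  have hξ : ∀ t, ξ (t + 1) = Matrix.toLin' A (ξ t) + B *ᵥ a t := by simpa using h
  rw [eq_pow_add_sum_of_recurrence _ hξ t, h0, map_zero, zero_add,
    dotProduct_sum, Finset.sum_comm]
  refine Finset.sum_congr rfl fun s _ => ?_
  have hB : B *ᵥ a s = ∑ j, a s j • fun i => B i j := by
    ext i
    simp [Matrix.mulVec, dotProduct, mul_comm]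
  rw [← Matrix.toLin'_pow, Matrix.toLin'_apply, hB, Matrix.mulVec_sum, dotProduct_sum]
  refine Finset.sum_congr rfl fun j _ => ?_
  rw [Matrix.mulVec_smul, dotProduct_smul, smul_eq_mul, mul_comm]

/-- In finite dimension, pointwise convergence of the powers of an operator to zero makes the norms
of the powers summable: the partial sums `T n` satisfy `T n ≤ T (n + N) ≤ T N + T n / 2` as soon as
`‖Φ ^ N‖ ≤ 1 / 2`. -/
lemma summable_norm_pow {E : Type*} [NormedAddCommGroup E] [NormedSpace ℝ E]
    [FiniteDimensional ℝ E] (Φ : E →L[ℝ] E)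
    (h : ∀ x, Tendsto (fun t : ℕ => (Φ ^ t) x) atTop (𝓝 0)) : Summable fun t : ℕ => ‖Φ ^ t‖ := by
  obtain ⟨C, -, hC⟩ := (Module.finBasis ℝ E).exists_opNorm_le (F := E)
  have hsum : Tendsto (fun t : ℕ => C * ∑ i, ‖(Φ ^ t) (Module.finBasis ℝ E i)‖) atTop (𝓝 0) := by
    have h' := fun i => (h (Module.finBasis ℝ E i)).norm
    simpa using (tendsto_finsetSum _ fun i _ => h' i).const_mul C
  have hlim : Tendsto (fun t : ℕ => ‖Φ ^ t‖) atTop (𝓝 0) :=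
    squeeze_zero (fun _ => norm_nonneg _) (fun t => hC (by positivity) fun i =>
      Finset.single_le_sum (f := fun i => ‖(Φ ^ t) (Module.finBasis ℝ E i)‖)
        (fun _ _ => norm_nonneg _) (Finset.mem_univ i)) hsum
  obtain ⟨N, hN⟩ : ∃ N : ℕ, ‖Φ ^ N‖ < 1 / 2 := (hlim.eventually_lt_const (by norm_num)).exists
  refine summable_of_sum_range_le (c := 2 * ∑ t ∈ Finset.range N, ‖Φ ^ t‖)
    (fun t => norm_nonneg _) fun n => ?_
  have h1 : ∑ t ∈ Finset.range n, ‖Φ ^ t‖ ≤ ∑ t ∈ Finset.range (N + n), ‖Φ ^ t‖ :=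
    Finset.sum_le_sum_of_subset_of_nonneg (by simp) fun _ _ _ => norm_nonneg _
  have h2 : ∑ t ∈ Finset.range n, ‖Φ ^ (N + t)‖ ≤ ∑ t ∈ Finset.range n, 1 / 2 * ‖Φ ^ t‖ := by
    refine Finset.sum_le_sum fun t _ => ?_
    rw [pow_add]
    exact (norm_mul_le _ _).trans (by gcongr)
  rw [Finset.sum_range_add] at h1
  rw [← Finset.mul_sum] at h2
  linarith

/-- Bounded-input bounded-output estimate with weights: Cauchy–Schwarz on the convolution of the
input with `‖Φ ^ s‖`. -/
lemma sq_norm_recurrence_le {E : Type*} [NormedAddCommGroup E] [NormedSpace ℝ E]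
    (Φ : E →L[ℝ] E) (hΦ : Summable fun t : ℕ => ‖Φ ^ t‖) {z f : ℕ → E}
    (h : ∀ t, z (t + 1) = Φ (z t) + f t) (t : ℕ) :
    ‖z t‖ ^ 2 ≤ 2 * (∑' s, ‖Φ ^ s‖) ^ 2 * ‖z 0‖ ^ 2 + 2 * (∑' s, ‖Φ ^ s‖) *
      ∑ s ∈ Finset.range t, ‖Φ ^ (t - 1 - s)‖ * ‖f s‖ ^ 2 := by
  set M := ∑' s, ‖Φ ^ s‖
  have hpow : ∀ s x, ((Φ : E →ₗ[ℝ] E) ^ s : Module.End ℝ E) x = (Φ ^ s) x := fun s x => by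
    rw [← ContinuousLinearMap.toLinearMap_pow]; rfl
  have hz := eq_pow_add_sum_of_recurrence (Φ : E →ₗ[ℝ] E) h t
  simp only [hpow] at hz
  have hM : ‖Φ ^ t‖ ≤ M := hΦ.le_tsum t fun _ _ => norm_nonneg _
  have hM0 : 0 ≤ M := tsum_nonneg fun _ => norm_nonneg _
  have hsum : ∑ s ∈ Finset.range t, ‖Φ ^ (t - 1 - s)‖ ≤ M := by
    rw [Finset.sum_range_reflect (fun s => ‖Φ ^ s‖)]
    exact hΦ.sum_le_tsum _ fun _ _ => norm_nonneg _
  have hCS : (∑ s ∈ Finset.range t, ‖Φ ^ (t - 1 - s)‖ * ‖f s‖) ^ 2 ≤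
      (∑ s ∈ Finset.range t, ‖Φ ^ (t - 1 - s)‖) *
        ∑ s ∈ Finset.range t, ‖Φ ^ (t - 1 - s)‖ * ‖f s‖ ^ 2 :=
    Finset.sum_sq_le_sum_mul_sum_of_sq_le_mul _ (fun _ _ => norm_nonneg _)
      (fun _ _ => by positivity) fun _ _ => le_of_eq (by ring)
  have hle : ‖z t‖ ≤ M * ‖z 0‖ + ∑ s ∈ Finset.range t, ‖Φ ^ (t - 1 - s)‖ * ‖f s‖ := by
    rw [hz]
    refine (norm_add_le _ _).trans (add_le_add ?_ ((norm_sum_le _ _).trans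
      (Finset.sum_le_sum fun s _ => ContinuousLinearMap.le_opNorm _ _)))
    exact (ContinuousLinearMap.le_opNorm _ _).trans (by gcongr)
  have hS : 0 ≤ ∑ s ∈ Finset.range t, ‖Φ ^ (t - 1 - s)‖ * ‖f s‖ ^ 2 :=
    Finset.sum_nonneg fun _ _ => by positivity
  calc ‖z t‖ ^ 2 ≤ (M * ‖z 0‖ + ∑ s ∈ Finset.range t, ‖Φ ^ (t - 1 - s)‖ * ‖f s‖) ^ 2 := by
        gcongr
    _ ≤ 2 * ((M * ‖z 0‖) ^ 2 + (∑ s ∈ Finset.range t, ‖Φ ^ (t - 1 - s)‖ * ‖f s‖) ^ 2) :=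
        add_sq_le
    _ ≤ 2 * ((M * ‖z 0‖) ^ 2 + M * ∑ s ∈ Finset.range t, ‖Φ ^ (t - 1 - s)‖ * ‖f s‖ ^ 2) := by
        have := mul_le_mul_of_nonneg_right hsum hS
        linarith
    _ = _ := by ring

/-! ### The closed loop as a linear system -/

namespace Loop

variable {n m p nL nF : ℕ} (sys : Loop n m p nL nF)

/-- The map `(s, d) ↦ v`. -/
def outVLin : (LoopState n nL nF × (Fin m → ℝ)) →ₗ[ℝ] ℝ where
  toFun a := sys.outV a.1 a.2
  map_add' a b := by
    simp [outV, outY, LTIFilter.out, Fin.sum_univ_two, dotProduct, mul_add,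
      Finset.sum_add_distrib]
    ring
  map_smul' r a := by
    simp [outV, outY, LTIFilter.out, Fin.sum_univ_two, dotProduct, mul_add, Finset.mul_sum,
      mul_left_comm]

lemma step_add (s s' : LoopState n nL nF) (d d' : Fin m → ℝ) (w w' : ℝ) :
    sys.step (s + s') (d + d') (w + w') = sys.step s d w + sys.step s' d' w' := by
  have h1 : ![s.2.1 + s'.2.1, sys.outY (s + s') (d + d')] =
      ![s.2.1, sys.outY s d] + ![s'.2.1, sys.outY s' d'] := by
    simp [outY, dotProduct_add]; ring
  have h2 : ![w + w'] = ![w] + ![w'] := by simp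
  simp only [step, LTIFilter.next, LTIFilter.out, Prod.fst_add, Prod.snd_add, h1, h2,
    Matrix.mulVec_add, dotProduct_add, Prod.mk_add_mk, Prod.mk.injEq, add_smul, true_and]
  refine ⟨by abel, by abel, by abel⟩

lemma step_smul (r : ℝ) (s : LoopState n nL nF) (d : Fin m → ℝ) (w : ℝ) :
    sys.step (r • s) (r • d) (r * w) = r • sys.step s d w := by
  have h1 : ![r * s.2.1, sys.outY (r • s) (r • d)] = r • ![s.2.1, sys.outY s d] := by
    simp [outY, mul_add]
  have h2 : ![r * w] = r • ![w] := by simp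
  simp only [step, LTIFilter.next, LTIFilter.out, Prod.smul_fst, Prod.smul_snd, smul_eq_mul, h1, h2,
    Matrix.mulVec_smul, dotProduct_smul, Prod.smul_mk, smul_add, add_smul, smul_smul]

/-- One step of the loop closed by `w = v + q`, as a linear map of the state and of the external
inputs `(d, q)`. -/
def closedStep : (LoopState n nL nF × (Fin m → ℝ) × ℝ) →ₗ[ℝ] LoopState n nL nF where
  toFun a := sys.step a.1 a.2.1 (sys.outVLin (a.1, a.2.1) + a.2.2)
  map_add' a b := by
    rw [← step_add]
    congr 1
    have : ((a + b).1, (a + b).2.1) = (a.1, a.2.1) + (b.1, b.2.1) := rfl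
    rw [this, map_add]
    simp only [Prod.snd_add]
    ring
  map_smul' r a := by
    rw [RingHom.id_apply, ← step_smul]
    congr 1
    have : ((r • a).1, (r • a).2.1) = r • (a.1, a.2.1) := rfl
    rw [this, map_smul]
    simp only [Prod.smul_snd, smul_eq_mul]
    ring

/-- The state transition operator of the closed loop. -/
noncomputable def transition : LoopState n nL nF →L[ℝ] LoopState n nL nF :=
  (sys.closedStep ∘ₗ LinearMap.inl ℝ _ _).toContinuousLinearMap

/-- The effect of the external inputs `(d, q)` on the state of the closed loop. -/
noncomputable def inputMap : ((Fin m → ℝ) × ℝ) →L[ℝ] LoopState n nL nF :=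
  (sys.closedStep ∘ₗ LinearMap.inr ℝ _ _).toContinuousLinearMap

lemma run_succ (s₀ : LoopState n nL nF) (d : ℕ → Fin m → ℝ) (q : ℕ → ℝ) (t : ℕ) :
    sys.run s₀ d (fun t v => v + q t) (t + 1) =
      sys.transition (sys.run s₀ d (fun t v => v + q t) t) + sys.inputMap (d t, q t) := by
  simp only [transition, inputMap, LinearMap.coe_toContinuousLinearMap', LinearMap.comp_apply,
    LinearMap.inl_apply, LinearMap.inr_apply]
  rw [← map_add]
  simp [closedStep, run, outVLin]

lemma run_eq (s₀ : LoopState n nL nF) (d : ℕ → Fin m → ℝ) (q : ℕ → ℝ) (t : ℕ) :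
    sys.run s₀ d (fun t v => v + q t) t = (sys.transition ^ t) s₀ +
      ∑ s ∈ Finset.range t, (sys.transition ^ (t - 1 - s)) (sys.inputMap (d s, q s)) := by
  have h := eq_pow_add_sum_of_recurrence
    (sys.transition : LoopState n nL nF →ₗ[ℝ] LoopState n nL nF)
    (z := sys.run s₀ d fun t v => v + q t) (f := fun t => sys.inputMap (d t, q t))
    (sys.run_succ s₀ d q) t
  simp only [← ContinuousLinearMap.toLinearMap_pow] at h
  exact h

lemma run_eq_add_rest (s₀ : LoopState n nL nF) (d : ℕ → Fin m → ℝ) (q : ℕ → ℝ) (t : ℕ) :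
    sys.run s₀ d (fun t v => v + q t) t =
      (sys.transition ^ t) s₀ + sys.run 0 d (fun t v => v + q t) t := by
  rw [run_eq, run_eq sys 0, map_zero, zero_add]

variable {sys}

lemma InternallyStable.summable_norm_pow (h : sys.InternallyStable) :
    Summable fun t : ℕ => ‖sys.transition ^ t‖ := by
  refine NCS.summable_norm_pow _ fun s₀ => (h s₀).congr fun t => ?_
  have h0 := sys.run_eq s₀ (fun _ => 0) (fun _ => 0) t
  simpa [← Prod.zero_eq_mk] using h0

variable (sys)

/-! ### Transfer functions of the closed loop -/

lemma constantCoeff_return_difference :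
    PowerSeries.constantCoeff (1 - sys.Lw * PowerSeries.X - sys.P₂₂ * sys.Ftf * sys.Ly) = 1 := by
  have h : PowerSeries.constantCoeff sys.P₂₂ = 0 := by
    rw [← PowerSeries.coeff_zero_eq_constantCoeff_apply, P₂₂, transferFn, PowerSeries.coeff_mk]
    rfl
  simp [h]

/-- The closed loop at rest maps `q` and `d` to `v` through `S - 1` and `L_y P₂₁ S`. -/
lemma mk_signal_eq (d : ℕ → Fin m → ℝ) (q : ℕ → ℝ) :
    (PowerSeries.mk fun t => sys.outV (sys.run 0 d (fun t v => v + q t) t) (d t)) =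
      (sys.S - 1) * PowerSeries.mk q +
        ∑ j, sys.Ly * sys.P₂₁ j * sys.S * PowerSeries.mk fun t => d t j := by
  set z := sys.run 0 d (fun t v => v + q t) with hz
  set v : ℕ → ℝ := fun t => sys.outV (z t) (d t) with hv
  set V := PowerSeries.mk v with hV
  set Q := PowerSeries.mk q with hQ
  set Y : ℝ⟦X⟧ := PowerSeries.mk fun t => sys.outY (z t) (d t) with hY
  set U : ℝ⟦X⟧ := PowerSeries.mk fun t => sys.F.out (z t).2.2.2 ![v t + q t] with hU
  have hz0 : z 0 = 0 := rfl
  have hz1 : ∀ t, z (t + 1) = sys.step (z t) (d t) (v t + q t) := fun t => rfl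
  have hFU : U = sys.Ftf * (V + Q) := by
    ext t
    have := output_eq_coeff_transferFn sys.F.A sys.F.B sys.F.C sys.F.D
      (ξ := fun t => (z t).2.2.2) (a := fun t => ![v t + q t]) (by simp [hz0])
      (fun t => by simp [hz1, step, LTIFilter.next]) t
    rw [hU, PowerSeries.coeff_mk, LTIFilter.out, this, Fin.sum_univ_one]
    rfl
  have hPY : Y = (∑ j, sys.P₂₁ j * PowerSeries.mk fun t => d t j) + sys.P₂₂ * U := by
    ext t
    have := output_eq_coeff_transferFn sys.P.A
      (Matrix.fromCols sys.P.B₁ (Matrix.replicateCol Unit sys.P.B₂)) sys.P.C₂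
      (Sum.elim sys.P.D₂₁ fun _ => 0)
      (ξ := fun t => (z t).1) (a := fun t => Sum.elim (d t)
        fun _ => sys.F.out (z t).2.2.2 ![v t + q t]) (by simp [hz0])
      (fun t => by
        rw [Matrix.fromCols_mulVec_sumElim, hz1]
        simp [step, add_assoc]
        ext i
        simp [Matrix.mulVec, dotProduct, mul_comm]) t
    rw [Fintype.sum_sum_type, Fintype.sum_unique (ι := Unit)] at this
    simp only [sumElim_dotProduct_sumElim, Sum.elim_inl, Sum.elim_inr] at this
    rw [hY, PowerSeries.coeff_mk, outY]
    have h0 : (fun _ : Unit => (0 : ℝ)) ⬝ᵥ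
        (fun _ => sys.F.out (z t).2.2.2 ![v t + q t]) = 0 := by simp [dotProduct]
    rw [h0, add_zero] at this
    exact this
  have hW : ∀ t, (z t).2.1 = PowerSeries.coeff t (PowerSeries.X * (V + Q)) := by
    intro t
    cases t with
    | zero => simp [hz0]
    | succ t => rw [mul_comm, PowerSeries.coeff_succ_mul_X]; simp [hz1, step, hV, hQ]
  have hLV : V = sys.Lw * (PowerSeries.X * (V + Q)) + sys.Ly * Y := by
    ext t
    have := output_eq_coeff_transferFn sys.L.A sys.L.B sys.L.C sys.L.D
      (ξ := fun t => (z t).2.2.1) (a := fun t => ![(z t).2.1, sys.outY (z t) (d t)])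
      (by simp [hz0]) (fun t => by simp [hz1, step, LTIFilter.next]) t
    rw [Fin.sum_univ_two] at this
    have hX : (PowerSeries.mk fun t => (z t).2.1) = PowerSeries.X * (V + Q) := by
      ext t; rw [PowerSeries.coeff_mk, hW]
    simp only [Matrix.cons_val_zero, Matrix.cons_val_one, hX] at this
    rw [hV, PowerSeries.coeff_mk]
    exact this
  have hS : sys.S * (1 - sys.Lw * PowerSeries.X - sys.P₂₂ * sys.Ftf * sys.Ly) = 1 :=
    PowerSeries.inv_mul_cancel _ (by rw [constantCoeff_return_difference]; exact one_ne_zero)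
  have hsum : ∑ j, sys.Ly * sys.P₂₁ j * sys.S * (PowerSeries.mk fun t => d t j) =
      sys.S * sys.Ly * ∑ j, sys.P₂₁ j * PowerSeries.mk fun t => d t j := by
    rw [Finset.mul_sum]
    exact Finset.sum_congr rfl fun j _ => by ring
  rw [hsum]
  -- the loop equation `(1 - G) V = G Q + L_y P₂₁ d` with `G = L_w z⁻¹ + P₂₂ F L_y`, and `S G = S - 1`
  rw [hPY, hFU] at hLV
  linear_combination (sys.S) * hLV + (-V - Q) * hS

lemma signal_eq_sum (d : ℕ → Fin m → ℝ) (q : ℕ → ℝ) (t : ℕ) :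
    sys.outV (sys.run 0 d (fun t v => v + q t) t) (d t) =
      (∑ s ∈ Finset.range (t + 1), PowerSeries.coeff s (sys.S - 1) * q (t - s)) +
        ∑ j, ∑ s ∈ Finset.range (t + 1),
          PowerSeries.coeff s (sys.Ly * sys.P₂₁ j * sys.S) * d (t - s) j := by
  have h := congrArg (PowerSeries.coeff t) (sys.mk_signal_eq d q)
  simpa only [PowerSeries.coeff_mk, map_add, map_sum, PowerSeries.coeff_mul,
    Finset.Nat.sum_antidiagonal_eq_sum_range_succ_mk] using h

/-- The response of `v` to inputs that act at time `0` only is square summable. -/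
lemma summable_sq_impulse_response (h : sys.InternallyStable) {d : ℕ → Fin m → ℝ} {q : ℕ → ℝ}
    (hd : ∀ t, d (t + 1) = 0) (hq : ∀ t, q (t + 1) = 0) :
    Summable fun t => sys.outV (sys.run 0 d (fun t v => v + q t) t) (d t) ^ 2 := by
  set z := sys.run 0 d (fun t v => v + q t) with hz
  have hz1 : ∀ t, z (t + 1) = (sys.transition ^ t) (sys.inputMap (d 0, q 0)) := by
    intro t
    rw [hz, run_eq, Finset.sum_eq_single_of_mem 0 (by simp)]
    · simp
    · intro s _ hs
      obtain ⟨s, rfl⟩ := Nat.exists_eq_succ_of_ne_zero hs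
      rw [hd, hq, ← Prod.zero_eq_mk, map_zero, map_zero]
  set c := sys.outVLin.toContinuousLinearMap with hc
  rw [← summable_nat_add_iff 1]
  have hs : Summable fun t => (‖c‖ * ‖sys.inputMap (d 0, q 0)‖) * ‖sys.transition ^ t‖ :=
    h.summable_norm_pow.mul_left _
  have hs2 : Summable fun t => ((‖c‖ * ‖sys.inputMap (d 0, q 0)‖) * ‖sys.transition ^ t‖) ^ 2 := by
    refine Summable.of_norm_bounded_eventually hs ?_
    rw [Nat.cofinite_eq_atTop]
    filter_upwards [hs.tendsto_atTop_zero.eventually_lt_const one_pos] with t ht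
    rw [Real.norm_of_nonneg (by positivity), sq]
    exact mul_le_of_le_one_left (by positivity) ht.le
  refine hs2.of_nonneg_of_le (fun _ => sq_nonneg _) fun t => ?_
  rw [← sq_abs]
  gcongr
  rw [hd, hz1]
  calc |sys.outV ((sys.transition ^ t) (sys.inputMap (d 0, q 0))) 0|
      = ‖c ((sys.transition ^ t) (sys.inputMap (d 0, q 0)), 0)‖ := rfl
    _ ≤ ‖c‖ * ‖(sys.transition ^ t) (sys.inputMap (d 0, q 0))‖ := by
        refine (c.le_opNorm _).trans_eq ?_
        rw [Prod.norm_def]; simp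
    _ ≤ ‖c‖ * (‖sys.transition ^ t‖ * ‖sys.inputMap (d 0, q 0)‖) := by
        gcongr; exact ContinuousLinearMap.le_opNorm _ _
    _ = _ := by ring

lemma summable_sq_coeff_S_sub_one (h : sys.InternallyStable) :
    Summable fun t => PowerSeries.coeff t (sys.S - 1) ^ 2 := by
  have hs := sys.summable_sq_impulse_response h (d := fun _ => 0)
    (q := fun t => if t = 0 then 1 else 0) (fun _ => rfl) (fun t => by simp)
  refine hs.congr fun t => ?_
  congr 1
  rw [sys.signal_eq_sum (fun _ => 0), Finset.sum_eq_single_of_mem t (by simp)]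
  · simp
  · intro s hs hne
    have hb : t - s ≠ 0 := by
      have := Finset.mem_range.1 hs
      omega
    simp [hb]

lemma summable_sq_coeff_Ly_P₂₁_S (h : sys.InternallyStable) (j : Fin m) :
    Summable fun t => PowerSeries.coeff t (sys.Ly * sys.P₂₁ j * sys.S) ^ 2 := by
  have hs := sys.summable_sq_impulse_response h (q := fun _ => 0)
    (d := fun t => if t = 0 then Pi.single j 1 else 0) (fun t => by simp) (fun _ => rfl)
  refine hs.congr fun t => ?_
  congr 1
  rw [sys.signal_eq_sum _ (fun _ => 0)]
  simp only [mul_zero, Finset.sum_const_zero, zero_add]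
  rw [Finset.sum_eq_single_of_mem j (by simp), Finset.sum_eq_single_of_mem t (by simp)]
  · simp
  · intro s hs hne
    have hb : t - s ≠ 0 := by
      have := Finset.mem_range.1 hs
      omega
    simp [hb]
  · intro i _ hi
    refine Finset.sum_eq_zero fun a _ => ?_
    split_ifs <;> simp [hi]

end Loop
variable {Ω : Type*} [MeasurableSpace Ω] {μ : Measure Ω}

/-! ### Second moments -/

lemma variance_fun_sum_mul_of_uncorrelated [IsFiniteMeasure μ] {ι : Type*} (s : Finset ι)
    {X : ι → Ω → ℝ} (a : ι → ℝ) {c : ℝ} (hX : ∀ i ∈ s, MemLp (X i) 2 μ)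
    (hvar : ∀ i ∈ s, cov[X i, X i; μ] = c)
    (hcov : ∀ i ∈ s, ∀ j ∈ s, i ≠ j → cov[X i, X j; μ] = 0) :
    Var[fun ω => ∑ i ∈ s, a i * X i ω; μ] = c * ∑ i ∈ s, a i ^ 2 := by
  rw [variance_fun_sum' fun i hi => (hX i hi).const_mul (a i), Finset.mul_sum]
  refine Finset.sum_congr rfl fun i hi => ?_
  rw [Finset.sum_eq_single_of_mem i hi]
  · rw [covariance_const_mul_left, covariance_const_mul_right, hvar i hi]
    ring
  · intro j hj hji
    rw [covariance_const_mul_left, covariance_const_mul_right, hcov i hi j hj hji.symm]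
    ring

/-- Cauchy–Schwarz, from the nonnegativity of the variance of `r X + Y` for all `r`. -/
lemma sq_covariance_le [IsProbabilityMeasure μ] {X Y : Ω → ℝ} (hX : MemLp X 2 μ)
    (hY : MemLp Y 2 μ) : cov[X, Y; μ] ^ 2 ≤ Var[X; μ] * Var[Y; μ] := by
  have h := discrim_le_zero (a := Var[X; μ]) (b := 2 * cov[X, Y; μ]) (c := Var[Y; μ]) fun r => by
    have := variance_nonneg (fun ω => r * X ω + Y ω) μ
    rw [variance_fun_add (hX.const_mul r) hY, variance_const_mul, covariance_const_mul_left] at this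
    linarith
  rw [discrim] at h
  linarith

/-- A perturbation whose variance vanishes in the limit does not change the limit of the variance,
however it is correlated with the unperturbed signal. -/
lemma tendsto_variance_add [IsProbabilityMeasure μ] {X Y : ℕ → Ω → ℝ} {c : ℝ}
    (hX : ∀ t, MemLp (X t) 2 μ) (hY : ∀ t, MemLp (Y t) 2 μ)
    (hX0 : Tendsto (fun t => Var[X t; μ]) atTop (𝓝 0))
    (hYc : Tendsto (fun t => Var[Y t; μ]) atTop (𝓝 c)) :
    Tendsto (fun t => Var[fun ω => X t ω + Y t ω; μ]) atTop (𝓝 c) := by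
  have hcov : Tendsto (fun t => cov[X t, Y t; μ]) atTop (𝓝 0) := by
    have h : Tendsto (fun t => √(Var[X t; μ] * Var[Y t; μ])) atTop (𝓝 0) := by
      simpa using (hX0.mul hYc).sqrt
    exact squeeze_zero_norm (fun t => Real.abs_le_sqrt (sq_covariance_le (hX t) (hY t))) h
  have := (hX0.add (hcov.const_mul 2)).add hYc
  simp only [mul_zero, zero_add] at this
  exact this.congr fun t => (variance_fun_add (hX t) (hY t)).symm

/-- A stable linear recursion driven by an input of bounded power has bounded power; the input
may be correlated in time in any way. -/
lemma exists_integral_sq_norm_le_of_recurrence {E : Type*} [NormedAddCommGroup E]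
    [NormedSpace ℝ E] (Φ : E →L[ℝ] E) (hΦ : Summable fun t : ℕ => ‖Φ ^ t‖)
    {z f : ℕ → Ω → E} (h : ∀ t ω, z (t + 1) ω = Φ (z t ω) + f t ω) (h0 : MemLp (z 0) 2 μ)
    (hf : ∀ t, MemLp (f t) 2 μ) {K : ℝ} (hK : ∀ t, ∫ ω, ‖f t ω‖ ^ 2 ∂μ ≤ K) :
    ∃ C, ∀ t, MemLp (z t) 2 μ ∧ ∫ ω, ‖z t ω‖ ^ 2 ∂μ ≤ C := by
  have hz : ∀ t, MemLp (z t) 2 μ := by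
    intro t
    induction t with
    | zero => exact h0
    | succ t ih =>
      have : z (t + 1) = (Φ ∘ z t) + f t := funext (h t)
      rw [this]
      exact (Φ.comp_memLp' ih).add (hf t)
  have hint : ∀ {g : Ω → E}, MemLp g 2 μ → Integrable (fun ω => ‖g ω‖ ^ 2) μ := fun hg =>
    hg.norm.integrable_sq
  have hK0 : 0 ≤ K := (integral_nonneg fun _ => sq_nonneg _).trans (hK 0)
  set M := ∑' s, ‖Φ ^ s‖
  have hM0 : 0 ≤ M := tsum_nonneg fun _ => norm_nonneg _
  refine ⟨2 * M ^ 2 * ∫ ω, ‖z 0 ω‖ ^ 2 ∂μ + 2 * M * (M * K), fun t => ⟨hz t, ?_⟩⟩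
  have hsum : ∑ s ∈ Finset.range t, ‖Φ ^ (t - 1 - s)‖ ≤ M := by
    rw [Finset.sum_range_reflect (fun s => ‖Φ ^ s‖)]
    exact hΦ.sum_le_tsum _ fun _ _ => norm_nonneg _
  have hi1 : Integrable (fun ω => ∑ s ∈ Finset.range t, ‖Φ ^ (t - 1 - s)‖ * ‖f s ω‖ ^ 2) μ :=
    integrable_finsetSum _ fun s _ => (hint (hf s)).const_mul _
  calc ∫ ω, ‖z t ω‖ ^ 2 ∂μ
      ≤ ∫ ω, (2 * M ^ 2 * ‖z 0 ω‖ ^ 2 + 2 * M *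
          ∑ s ∈ Finset.range t, ‖Φ ^ (t - 1 - s)‖ * ‖f s ω‖ ^ 2) ∂μ :=
        integral_mono (hint (hz t)) (((hint h0).const_mul _).add (hi1.const_mul _)) fun ω =>
          sq_norm_recurrence_le Φ hΦ (z := fun t => z t ω) (f := fun t => f t ω)
            (fun t => h t ω) t
    _ = 2 * M ^ 2 * ∫ ω, ‖z 0 ω‖ ^ 2 ∂μ + 2 * M *
          ∑ s ∈ Finset.range t, ‖Φ ^ (t - 1 - s)‖ * ∫ ω, ‖f s ω‖ ^ 2 ∂μ := by
        rw [integral_add ((hint h0).const_mul _) (hi1.const_mul _), integral_const_mul,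
          integral_const_mul, integral_finsetSum _ fun s _ => (hint (hf s)).const_mul _]
        simp only [integral_const_mul]
    _ ≤ _ := by
        gcongr
        calc ∑ s ∈ Finset.range t, ‖Φ ^ (t - 1 - s)‖ * ∫ ω, ‖f s ω‖ ^ 2 ∂μ
            ≤ ∑ s ∈ Finset.range t, ‖Φ ^ (t - 1 - s)‖ * K := by gcongr; exact hK _
          _ ≤ M * K := by rw [← Finset.sum_mul]; gcongr

/-! ### The disturbance -/

namespace IsGaussianDisturbance

variable {n m : ℕ} {x₀ : Ω → Fin n → ℝ} {d : ℕ → Ω → Fin m → ℝ}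

lemma memLp_initial (h : IsGaussianDisturbance μ x₀ d) : MemLp x₀ 2 μ :=
  MemLp.of_eval fun i => (h.gaussian.hasGaussianLaw_eval (Sum.inl i)).memLp_two

lemma memLp_eval (h : IsGaussianDisturbance μ x₀ d) (t : ℕ) (j : Fin m) :
    MemLp (fun ω => d t ω j) 2 μ :=
  (h.gaussian.hasGaussianLaw_eval (Sum.inr (t, j))).memLp_two

lemma memLp_initial_loopState [IsFiniteMeasure μ] (h : IsGaussianDisturbance μ x₀ d) {nL nF : ℕ} :
    MemLp (fun ω => ((x₀ ω, 0, 0, 0) : LoopState n nL nF)) 2 μ :=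
  MemLp.of_fst_snd ⟨h.memLp_initial, memLp_const (0 : ℝ × (Fin nL → ℝ) × (Fin nF → ℝ))⟩

lemma integral_sq_eval (h : IsGaussianDisturbance μ x₀ d) (t : ℕ) (j : Fin m) :
    ∫ ω, d t ω j ^ 2 ∂μ = 1 := by
  have hm := (h.memLp_eval t j).aestronglyMeasurable.aemeasurable
  rw [← variance_of_integral_eq_zero hm (h.mean t j), ← covariance_self hm, h.cov]
  simp

end IsGaussianDisturbance

/-! ### Mean-square stability and the steady-state variance -/

namespace Loop

variable {n m p nL nF : ℕ} {sys : Loop n m p nL nF} [IsProbabilityMeasure μ]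
  {x₀ : Ω → Fin n → ℝ} {d : ℕ → Ω → Fin m → ℝ}

/-- An internally stable loop is mean-square stable for every additive channel noise of bounded
power. -/
lemma InternallyStable.meanSquareStable (hs : sys.InternallyStable)
    (hd : IsGaussianDisturbance μ x₀ d) {q : ℕ → Ω → ℝ} (hq : ∀ t, MemLp (q t) 2 μ) {K : ℝ}
    (hK : ∀ t, ∫ ω, q t ω ^ 2 ∂μ ≤ K) :
    MeanSquareStable μ fun t ω =>
      sys.plantState (x₀ ω) (fun t => d t ω) (fun t v => v + q t ω) t := by
  have hdt : ∀ t, MemLp (d t) 2 μ := fun t => MemLp.of_eval (hd.memLp_eval t)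
  have hin : ∀ t, MemLp (fun ω => (d t ω, q t ω)) 2 μ := fun t =>
    MemLp.of_fst_snd ⟨hdt t, hq t⟩
  have hpow : ∀ t, ∫ ω, ‖sys.inputMap (d t ω, q t ω)‖ ^ 2 ∂μ ≤ ‖sys.inputMap‖ ^ 2 * (m + K) := by
    intro t
    have hi : Integrable (fun ω => ∑ j, d t ω j ^ 2) μ :=
      integrable_finsetSum _ fun j _ => (hd.memLp_eval t j).integrable_sq
    calc ∫ ω, ‖sys.inputMap (d t ω, q t ω)‖ ^ 2 ∂μ
        ≤ ∫ ω, ‖sys.inputMap‖ ^ 2 * (∑ j, d t ω j ^ 2 + q t ω ^ 2) ∂μ := by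
          refine integral_mono (sys.inputMap.comp_memLp' (hin t)).norm.integrable_sq
            ((hi.add (hq t).integrable_sq).const_mul _) fun ω => ?_
          have h1 : ‖(d t ω, q t ω)‖ ^ 2 ≤ ∑ j, d t ω j ^ 2 + q t ω ^ 2 := by
            have hS : 0 ≤ ∑ j, d t ω j ^ 2 := Finset.sum_nonneg fun _ _ => sq_nonneg _
            refine (Real.le_sqrt (norm_nonneg _) (by positivity)).1 ?_
            rw [Prod.norm_def]
            refine max_le ((pi_norm_le_iff_of_nonneg (Real.sqrt_nonneg _)).2 fun j => ?_) ?_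
            · refine Real.abs_le_sqrt ?_
              have := Finset.single_le_sum (f := fun j => d t ω j ^ 2)
                (fun _ _ => sq_nonneg _) (Finset.mem_univ j)
              nlinarith [sq_nonneg (q t ω)]
            · exact Real.abs_le_sqrt (by linarith)
          calc ‖sys.inputMap (d t ω, q t ω)‖ ^ 2
              ≤ (‖sys.inputMap‖ * ‖(d t ω, q t ω)‖) ^ 2 := by
                gcongr; exact ContinuousLinearMap.le_opNorm _ _
            _ ≤ _ := by rw [mul_pow]; gcongr
      _ = ‖sys.inputMap‖ ^ 2 * (m + ∫ ω, q t ω ^ 2 ∂μ) := by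
          rw [integral_const_mul, integral_add hi (hq t).integrable_sq,
            integral_finsetSum _ fun j _ => (hd.memLp_eval t j).integrable_sq]
          simp [hd.integral_sq_eval]
      _ ≤ _ := by gcongr; exact hK t
  obtain ⟨C, hC⟩ := exists_integral_sq_norm_le_of_recurrence (E := LoopState n nL nF)
    sys.transition hs.summable_norm_pow
    (z := fun t ω => sys.run (x₀ ω, 0, 0, 0) (fun t => d t ω) (fun t v => v + q t ω) t)
    (f := fun t ω => sys.inputMap (d t ω, q t ω))
    (fun t ω => sys.run_succ _ _ (fun t => q t ω) t)
    hd.memLp_initial_loopState (fun t => sys.inputMap.comp_memLp' (hin t)) hpow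
  intro i j
  refine ⟨C, fun t => ⟨?_, ?_⟩⟩
  · exact ((hC t).1.fst.eval i).integrable_mul ((hC t).1.fst.eval j)
  · rw [← Real.norm_eq_abs]
    refine (norm_integral_le_of_norm_le (hC t).1.norm.integrable_sq
      (Eventually.of_forall fun ω => ?_)).trans (hC t).2
    have hle : ∀ l, ‖(sys.run (x₀ ω, 0, 0, 0) (fun t => d t ω) (fun t v => v + q t ω) t).1 l‖ ≤
        ‖sys.run (x₀ ω, 0, 0, 0) (fun t => d t ω) (fun t v => v + q t ω) t‖ := fun l =>
      (norm_le_pi_norm _ l).trans (norm_fst_le _)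
    rw [norm_mul, sq]
    exact mul_le_mul (hle i) (hle j) (norm_nonneg _) (norm_nonneg _)

/-- The variance of the response of `v` to `d` and `q`, the loop starting at rest. -/
lemma variance_signal_rest (hd : IsGaussianDisturbance μ x₀ d) {q : ℕ → Ω → ℝ} {varQ : ℝ}
    (hq : IsWhiteGaussianNoise μ q varQ)
    (hind : IndepFun (fun ω t => q t ω) (fun ω => (x₀ ω, fun t => d t ω)) μ) (t : ℕ) :
    MemLp (fun ω => sys.outV (sys.run 0 (fun t => d t ω) (fun t v => v + q t ω) t) (d t ω)) 2 μ ∧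
    Var[fun ω => sys.outV (sys.run 0 (fun t => d t ω) (fun t v => v + q t ω) t) (d t ω); μ] =
      varQ * ∑ s ∈ Finset.range (t + 1), PowerSeries.coeff s (sys.S - 1) ^ 2 +
        ∑ j, ∑ s ∈ Finset.range (t + 1),
          PowerSeries.coeff s (sys.Ly * sys.P₂₁ j * sys.S) ^ 2 := by
  have hq2 : ∀ t, MemLp (q t) 2 μ := fun t => (hq.gaussian.hasGaussianLaw_eval t).memLp_two
  have hsig : (fun ω => sys.outV (sys.run 0 (fun t => d t ω) (fun t v => v + q t ω) t) (d t ω)) =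
      fun ω => (∑ s ∈ Finset.range (t + 1), PowerSeries.coeff s (sys.S - 1) * q (t - s) ω) +
        ∑ a ∈ Finset.univ ×ˢ Finset.range (t + 1),
          PowerSeries.coeff a.2 (sys.Ly * sys.P₂₁ a.1 * sys.S) * d (t - a.2) ω a.1 := by
    funext ω
    rw [sys.signal_eq_sum (fun t => d t ω) (fun t => q t ω), Finset.sum_product]
  have hQ : MemLp (fun ω => ∑ s ∈ Finset.range (t + 1),
      PowerSeries.coeff s (sys.S - 1) * q (t - s) ω) 2 μ :=
    memLp_finsetSum _ fun s _ => (hq2 _).const_mul _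
  have hD : MemLp (fun ω => ∑ a ∈ Finset.univ ×ˢ Finset.range (t + 1),
      PowerSeries.coeff a.2 (sys.Ly * sys.P₂₁ a.1 * sys.S) * d (t - a.2) ω a.1) 2 μ :=
    memLp_finsetSum _ fun a _ => (hd.memLp_eval _ _).const_mul _
  have hQD := hind.comp
    (φ := fun w => ∑ s ∈ Finset.range (t + 1), PowerSeries.coeff s (sys.S - 1) * w (t - s))
    (ψ := fun w => ∑ a ∈ Finset.univ ×ˢ Finset.range (t + 1),
      PowerSeries.coeff a.2 (sys.Ly * sys.P₂₁ a.1 * sys.S) * w.2 (t - a.2) a.1)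
    (by fun_prop) (by fun_prop)
  rw [hsig]
  refine ⟨hQ.add hD, ?_⟩
  rw [IndepFun.variance_fun_add hQ hD hQD]
  congr 1
  · refine variance_fun_sum_mul_of_uncorrelated _ _ (fun s _ => hq2 _) (fun s _ => ?_) ?_
    · rw [hq.cov, if_pos rfl]
    · intro s hs r hr hsr
      have h1 := Finset.mem_range.1 hs
      have h2 := Finset.mem_range.1 hr
      rw [hq.cov, if_neg (by omega)]
  · rw [variance_fun_sum_mul_of_uncorrelated _ _ (c := 1) (fun a _ => hd.memLp_eval _ _)
      (fun a _ => by rw [hd.cov, if_pos ⟨rfl, rfl⟩]) ?_, one_mul, Finset.sum_product]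
    · intro a ha b hb hab
      have h1 := Finset.mem_range.1 (Finset.mem_product.1 ha).2
      have h2 := Finset.mem_range.1 (Finset.mem_product.1 hb).2
      rw [hd.cov, if_neg fun h => hab (Prod.ext h.2 (by omega))]

/-- The initial state is forgotten: its contribution to `v` has vanishing variance. -/
lemma InternallyStable.tendsto_variance_transient (hs : sys.InternallyStable)
    (hd : IsGaussianDisturbance μ x₀ d) :
    (∀ t, MemLp (fun ω => sys.outV ((sys.transition ^ t) (x₀ ω, 0, 0, 0)) 0) 2 μ) ∧
    Tendsto (fun t => Var[fun ω => sys.outV ((sys.transition ^ t) (x₀ ω, 0, 0, 0)) 0; μ])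
      atTop (𝓝 0) := by
  set c : LoopState n nL nF →L[ℝ] ℝ :=
    (sys.outVLin ∘ₗ LinearMap.inl ℝ _ _).toContinuousLinearMap with hc
  have hx := hd.memLp_initial_loopState (nL := nL) (nF := nF)
  have hmem : ∀ t, MemLp (fun ω => sys.outV ((sys.transition ^ t) (x₀ ω, 0, 0, 0)) 0) 2 μ :=
    fun t => (c ∘L (sys.transition ^ t)).comp_memLp' hx
  refine ⟨hmem, ?_⟩
  have hlim : Tendsto (fun t => (‖c‖ * ‖sys.transition ^ t‖) ^ 2 *
      ∫ ω, ‖((x₀ ω, 0, 0, 0) : LoopState n nL nF)‖ ^ 2 ∂μ) atTop (𝓝 0) := by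
    have := ((hs.summable_norm_pow.tendsto_atTop_zero.const_mul ‖c‖).pow 2).mul_const
      (∫ ω, ‖((x₀ ω, 0, 0, 0) : LoopState n nL nF)‖ ^ 2 ∂μ)
    simpa using this
  refine squeeze_zero (fun t => variance_nonneg _ _) (fun t => ?_) hlim
  refine (variance_le_expectation_sq (hmem t).aestronglyMeasurable).trans ?_
  rw [← integral_const_mul]
  refine integral_mono (hmem t).integrable_sq (hx.norm.integrable_sq.const_mul _) fun ω => ?_
  change c ((sys.transition ^ t) (x₀ ω, 0, 0, 0)) ^ 2 ≤ _
  rw [← sq_abs, ← mul_pow, ← Real.norm_eq_abs, mul_assoc]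
  gcongr
  exact (c.le_opNorm _).trans (by gcongr; exact ContinuousLinearMap.le_opNorm _ _)

end Loop

/-- The steady-state variance `σ_v² = ‖S - 1‖² σ_q² + ‖L_y P₂₁ S‖²`. -/
lemma IsLinearSystem.varV_eq {n m p nL nF : ℕ} {sys : Loop n m p nL nF} [IsProbabilityMeasure μ]
    {x₀ : Ω → Fin n → ℝ} {d : ℕ → Ω → Fin m → ℝ} {q : ℕ → Ω → ℝ} {varQ varV γ : ℝ}
    (h : IsLinearSystem sys μ x₀ d q varQ varV γ) :
    varV = sys.criticalSNR * varQ + sys.normSqLyP₂₁S := by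
  refine tendsto_nhds_unique h.tendsto_varV ?_
  have hrest := Loop.variance_signal_rest (sys := sys) h.disturbance h.noise h.indep
  have htrans := h.stable.tendsto_variance_transient h.disturbance
  have hlim : Tendsto (fun t => Var[fun ω => sys.outV (sys.run 0 (fun t => d t ω)
      (fun t v => v + q t ω) t) (d t ω); μ]) atTop
      (𝓝 (sys.criticalSNR * varQ + sys.normSqLyP₂₁S)) := by
    simp only [(hrest _).2, mul_comm sys.criticalSNR]
    refine Tendsto.add (Tendsto.const_mul _ ?_) (tendsto_finsetSum _ fun j _ => ?_)
    · exact (tendsto_add_atTop_iff_nat 1).2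
        (sys.summable_sq_coeff_S_sub_one h.stable).hasSum.tendsto_sum_nat
    · exact (tendsto_add_atTop_iff_nat 1).2
        (sys.summable_sq_coeff_Ly_P₂₁_S h.stable j).hasSum.tendsto_sum_nat
  refine (tendsto_variance_add htrans.1 (fun t => (hrest t).1) htrans.2 hlim).congr fun t => ?_
  congr 1
  funext ω
  rw [Loop.signalV, sys.run_eq_add_rest (x₀ ω, 0, 0, 0) _ (fun t => q t ω)]
  have := sys.outVLin.map_add ((sys.transition ^ t) (x₀ ω, 0, 0, 0), 0)
    (sys.run 0 (fun t => d t ω) (fun t v => v + q t ω) t, d t ω)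
  rw [Prod.mk_add_mk, zero_add] at this
  exact this.symm

/-! ### Averaged descriptions -/

lemma average_const_add {k : ℕ} {I : Finset (Fin k)} (hI : I.card ≠ 0) (v : ℝ) (a : Fin k → ℝ) :
    (average I fun i => v + a i) = v + average I a := by
  have : (I.card : ℝ) ≠ 0 := by exact_mod_cast hI
  simp only [average, Finset.sum_add_distrib, Finset.sum_const, nsmul_eq_mul]
  field_simp

lemma memLp_average {k : ℕ} (I : Finset (Fin k)) {a : Fin k → Ω → ℝ}
    (ha : ∀ i, MemLp (a i) 2 μ) : MemLp (fun ω => average I fun i => a i ω) 2 μ := by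
  simp only [average, div_eq_mul_inv]
  exact (memLp_finsetSum I fun i _ => ha i).mul_const _

lemma integral_average [IsFiniteMeasure μ] {k : ℕ} (I : Finset (Fin k)) {a : Fin k → Ω → ℝ}
    (ha : ∀ i, MemLp (a i) 2 μ) (h0 : ∀ i, ∫ ω, a i ω ∂μ = 0) :
    ∫ ω, average I (fun i => a i ω) ∂μ = 0 := by
  simp only [average]
  rw [integral_div, integral_finsetSum _ fun i _ => (ha i).integrable (by norm_num)]
  simp [h0]

/-- Negative correlation of the summands lowers the variance of their average below
`σ ^ 2 / I.card`. -/
lemma variance_average [IsFiniteMeasure μ] {k : ℕ} {I : Finset (Fin k)} (hI : I.card ≠ 0)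
    {a : Fin k → Ω → ℝ} {σ ρ : ℝ} (hσ : 0 < σ) (ha : ∀ i, MemLp (a i) 2 μ)
    (hvar : ∀ i, Var[a i; μ] = σ ^ 2) (hcorr : ∀ i j, i ≠ j → corr (a i) (a j) μ = ρ) :
    Var[fun ω => average I fun i => a i ω; μ] =
      σ ^ 2 * (1 + ((I.card : ℝ) - 1) * ρ) / I.card := by
  have hcard : (I.card : ℝ) ≠ 0 := by exact_mod_cast hI
  have hcov : ∀ i j, cov[a i, a j; μ] = ρ * σ ^ 2 + if i = j then (1 - ρ) * σ ^ 2 else 0 := by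
    intro i j
    split_ifs with hij
    · subst hij
      rw [covariance_self (ha i).aestronglyMeasurable.aemeasurable, hvar]
      ring
    · have := hcorr i j hij
      rw [corr, hvar, hvar, Real.sqrt_sq hσ.le, div_eq_iff (by positivity)] at this
      rw [this]
      ring
  simp only [average, div_eq_mul_inv]
  rw [variance_mul_const, variance_fun_sum' fun i _ => ha i]
  simp only [hcov, Finset.sum_add_distrib, Finset.sum_const, Finset.sum_ite_eq, nsmul_eq_mul]
  rw [Finset.sum_congr rfl fun i hi => if_pos hi, Finset.sum_const, nsmul_eq_mul]
  field_simp
  ring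

end NCS

theorem lemma5 {n m p nL nF : ℕ} (sys : NCS.Loop n m p nL nF)
    {Ω : Type*} [MeasurableSpace Ω] (μ : Measure Ω) [IsProbabilityMeasure μ]
    (x₀ : Ω → Fin n → ℝ) (d : ℕ → Ω → Fin m → ℝ) (q₀ : ℕ → Ω → ℝ) (varQ varV γ : ℝ)
    (hsys : NCS.IsLinearSystem sys μ x₀ d q₀ varQ varV γ)
    (hγ : sys.criticalSNR < γ)
    (k k' : ℕ) (hk : 2 ≤ k) (hk'_pos : 1 ≤ k') (hk' : k' ≤ k)
    (q : Fin k → ℕ → Ω → ℝ) (σ ρ : ℝ) (hσ : 0 < σ)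
    (hq_L2 : ∀ i t, MemLp (q i t) 2 μ)
    (hq_mean : ∀ i t, ∫ ω, q i t ω ∂μ = 0)
    (hq_var : ∀ i t, Var[q i t; μ] = σ ^ 2)
    (hq_corr : ∀ i j, i ≠ j → ∀ t, NCS.corr (q i t) (q j t) μ = ρ)
    (hρ_lower : -(1 / ((k : ℝ) - 1)) < ρ) (hρ_upper : ρ ≤ 0)
    -- if `‖S - 1‖ = 0`, the right-hand side is `+∞` and there is no restriction on `σ`
    (hcode : sys.criticalSNR ≠ 0 →
      σ ^ 2 ≤ γ * k' * sys.normSqLyP₂₁S /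
        (sys.criticalSNR * (γ - sys.criticalSNR) * (1 + ((k' : ℝ) - 1) * ρ))) :
    NCS.IsStabilizingCode sys μ x₀ d varV k' q := by
  intro I hI
  have hI0 : I.card ≠ 0 := by omega
  have hvar : ∀ t, Var[fun ω => NCS.average I fun i => q i t ω; μ] =
      σ ^ 2 * (1 + ((k' : ℝ) - 1) * ρ) / k' := fun t => by
    rw [NCS.variance_average hI0 hσ (fun i => hq_L2 i t) (fun i => hq_var i t)
      (fun i j hij => hq_corr i j hij t), hI]
  have hkR : (1 : ℝ) < k := by exact_mod_cast hk
  have hk1 : (1 : ℝ) ≤ k' := by exact_mod_cast hk'_pos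
  have hk'R : (k' : ℝ) ≤ k := by exact_mod_cast hk'
  -- since `ρ ≤ 0`, the case `k' = k` is the worst one
  have hden : 0 < 1 + ((k' : ℝ) - 1) * ρ := by
    have h1 : -1 < ((k : ℝ) - 1) * ρ := by
      rw [← neg_div, div_lt_iff₀ (by linarith)] at hρ_lower
      linarith
    nlinarith
  constructor
  · intro t
    have hcrit : 0 ≤ sys.criticalSNR := tsum_nonneg fun _ => sq_nonneg _
    have hV := hsys.varV_eq
    have hQ := hsys.varQ_pos
    have hγV : γ * varQ = varV := by rw [hsys.snr]; field_simp
    rw [hvar, le_div_iff₀ (by positivity)]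
    rcases hcrit.eq_or_lt with h0 | hpos
    · rw [← h0, zero_mul, ← hγV]
      exact mul_nonneg (hcrit.trans hγ.le) hQ.le
    · have hgap : 0 < γ - sys.criticalSNR := sub_pos.2 hγ
      -- `‖L_y P₂₁ S‖²` is the part of `varV` by which `γ` exceeds the critical ratio
      have hN : sys.normSqLyP₂₁S = (γ - sys.criticalSNR) * varQ := by
        rw [sub_mul, hγV]; linarith
      have h := hcode hpos.ne'
      rw [hN, le_div_iff₀ (by positivity)] at h
      rw [mul_div_assoc', div_le_iff₀ (by positivity), ← hγV]
      refine le_of_mul_le_mul_left ?_ hgap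
      linarith
  · simp only [NCS.average_const_add hI0]
    refine hsys.stable.meanSquareStable hsys.disturbance
      (fun t => NCS.memLp_average I fun i => hq_L2 i t)
      (K := σ ^ 2 * (1 + ((k' : ℝ) - 1) * ρ) / k') fun t => le_of_eq ?_
    rw [← hvar t, variance_of_integral_eq_zero
      (NCS.memLp_average I fun i => hq_L2 i t).aestronglyMeasurable.aemeasurable
      (NCS.integral_average I (fun i => hq_L2 i t) fun i => hq_mean i t)]
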